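/- Let $F$ be any field and $d\ge 2$ an integer. A matrix $H\in F^{2d\times 2d}$ is called symplectic if $H^TJH=J$, where $J=\begin{bmatrix}0&I\\-I&0\end{bmatrix}$ (blocks of size $d\times d$); let $\mathcal{SP}=Sp(d,F)$ be the group of symplectic matrices. Let $\mathcal T$ be the set of all matrices $\begin{bmatrix}I&S\\0&I\end{bmatrix}$ and $\begin{bmatrix}I&0\\S&I\end{bmatrix}$ with $S\in F^{d\times d}$, $S^T=S$, and for $n\ge 0$ let $\mathcal L_n=\{H_n\cdots H_2H_1 : H_1,\dots,H_n\in\mathcal T\}$ (with $\mathcal L_0=\{I\}$). (1) For every $H\in\mathcal{SP}$ there exist $\delta_1,\dots,\delta_d\in\{0,1\}\subset F$ and symmetric $S,T,U,V\in F^{d\times d}$ such that $$H=\begin{bmatrix}I&\operatorname{diag}(\delta_1,\dots,\delta_d)\\0&I\end{bmatrix}\begin{bmatrix}I&0\\S&I\end{bmatrix}\begin{bmatrix}I&T\\0&I\end{bmatrix}\begin{bmatrix}I&0\\U&I\end{bmatrix}\begin{bmatrix}I&V\\0&I\end{bmatrix}.$$ (2) $\mathcal L_4\subsetneq\mathcal{SP}=\mathcal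 L_5$. (3) For every nonsingular, non-symmetric $Q\in F^{d\times d}$, the matrix $\begin{bmatrix}0&Q\\-Q^{-T}&0\end{bmatrix}$ (where $Q^{-T}=(Q^T)^{-1}$) lies in $\mathcal{SP}$ but not in $\mathcal L_4$. (4) Five factors is optimal: $5$ is the smallest integer $n\ge 0$ with $\mathcal L_n=\mathcal{SP}$. -/

import Mathlib

open Matrix

namespace SympFactor

/-- The unit triangular symplectic matrices: `[[I, S], [0, I]]` and `[[I, 0], [S, I]]`
with `S` symmetric. -/
def unitTriangular (d : ℕ) (F : Type*) [Field F] :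
    Set (Matrix (Fin d ⊕ Fin d) (Fin d ⊕ Fin d) F) :=
  {H | ∃ S : Matrix (Fin d) (Fin d) F, S.IsSymm ∧
    (H = fromBlocks 1 S 0 1 ∨ H = fromBlocks 1 0 S 1)}

/-- The set of all products `Hₙ ⋯ H₂ H₁` of exactly `n` unit triangular symplectic matrices
(upper and lower ones in any order). -/
def unitTriangularProducts (d : ℕ) (F : Type*) [Field F] (n : ℕ) :
    Set (Matrix (Fin d ⊕ Fin d) (Fin d ⊕ Fin d) F) :=
  {H | ∃ l : List (Matrix (Fin d ⊕ Fin d) (Fin d ⊕ Fin d) F),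
    l.length = n ∧ (∀ M ∈ l, M ∈ unitTriangular d F) ∧ H = l.prod}

/-- Mathlib's symplectic group, `H J Hᵀ = J` for `J = [[0, -I], [I, 0]]`, is the set of
matrices with `Hᵀ J H = J` for `J = [[0, I], [-I, 0]]`. -/
theorem mem_symplecticGroup_iff_transpose_mul (d : ℕ) (F : Type*) [Field F]
    (H : Matrix (Fin d ⊕ Fin d) (Fin d ⊕ Fin d) F) :
    H ∈ symplecticGroup (Fin d) F ↔
      Hᵀ * fromBlocks 0 1 (-1) 0 * H = fromBlocks 0 1 (-1) 0 := by
  have hJ : (fromBlocks 0 1 (-1) 0 : Matrix (Fin d ⊕ Fin d) (Fin d ⊕ Fin d) F)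
      = -J (Fin d) F := by
    rw [J, fromBlocks_neg]; simp
  rw [hJ, SymplecticGroup.mem_iff']
  simp

end SympFactor

/-! Write `H = [[A, B], [C, D]]`. Since `AᵀC` is symmetric and `[A; C]` has full column rank, some
0/1 diagonal shear makes `A - diag(δ) C` invertible, which costs one factor. A symplectic matrix
with invertible corner `A` is lower · `diag(A, A⁻ᵀ)` · upper. Writing `A - 1 = T U` with `T`, `U`
symmetric gives upper(`T`) · lower(`U`) the same corner, hence the same middle factor, so four
factors suffice. For optimality, four factors with product `[[0, Q], [R, 0]]` force `Q` or `R` to be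
symmetric. -/

/-! ### Products of two symmetric matrices -/

open Polynomial in
/-- For `p` irreducible, `F[X] ⧸ (p ^ e)` carries a linear functional whose kernel contains no
nonzero ideal. -/
theorem exists_functional_quotient_prime_pow {F : Type*} [Field F] (p : F[X]) (hp : Irreducible p)
    (e : ℕ) : ∃ l : (F[X] ⧸ Ideal.span {p ^ e}) →ₗ[F] F, ∀ u, (∀ w, l (u * w) = 0) → u = 0 := by
  classical
  rcases e with _ | e
  · refine ⟨0, fun u _ => ?_⟩
    obtain ⟨g, rfl⟩ := Ideal.Quotient.mk_surjective u
    rw [Ideal.Quotient.eq_zero_iff_mem, Ideal.mem_span_singleton]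
    simp
  -- The class of `p ^ e` generates the smallest nonzero ideal of the quotient by `p ^ (e + 1)`, so
  -- any functional nonzero at it works.
  have hz : Ideal.Quotient.mk (Ideal.span {p ^ (e + 1)}) (p ^ e) ≠ 0 := by
    rw [Ne, Ideal.Quotient.eq_zero_iff_mem, Ideal.mem_span_singleton,
      pow_dvd_pow_iff hp.ne_zero hp.not_isUnit]
    omega
  obtain ⟨l, hl⟩ := Module.Projective.exists_dual_ne_zero F hz
  refine ⟨l, fun u hu => ?_⟩
  obtain ⟨g, rfl⟩ := Ideal.Quotient.mk_surjective u
  by_contra hg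
  rw [Ideal.Quotient.eq_zero_iff_mem, Ideal.mem_span_singleton] at hg
  obtain ⟨k, hk, hkg⟩ := (dvd_prime_pow hp.prime (e + 1)).1
    (EuclideanDomain.gcd_dvd_right g (p ^ (e + 1)))
  have hke : k ≤ e := by
    by_contra h
    obtain rfl : k = e + 1 := by omega
    exact hg (hkg.symm.dvd.trans (EuclideanDomain.gcd_dvd_left _ _))
  obtain ⟨c, hc⟩ := hkg.dvd.trans (pow_dvd_pow p hke)
  rw [EuclideanDomain.gcd_eq_gcd_ab] at hc
  apply hl
  have : Ideal.Quotient.mk (Ideal.span {p ^ (e + 1)}) (p ^ e) =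
      Ideal.Quotient.mk _ g * Ideal.Quotient.mk _
        (EuclideanDomain.gcdA g (p ^ (e + 1)) * c) := by
    rw [← map_mul, Ideal.Quotient.eq, Ideal.mem_span_singleton]
    exact ⟨EuclideanDomain.gcdB g (p ^ (e + 1)) * c, by rw [hc]; ring⟩
  rw [this]
  exact hu _

open Polynomial Module in
/-- Every endomorphism of a finite-dimensional space is self-adjoint for some nondegenerate
symmetric bilinear form. -/
theorem exists_nondegenerate_symm_selfAdjoint {F V : Type*} [Field F] [AddCommGroup V] [Module F V]
    [FiniteDimensional F V] (f : V →ₗ[F] V) :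
    ∃ B : LinearMap.BilinForm F V, B.Nondegenerate ∧ (∀ x y, B x y = B y x) ∧
      ∀ x y, B (f x) y = B x (f y) := by
  classical
  -- With `X` acting as `f`, `V` is a finite sum of quotients `F[X] ⧸ (pᵢ ^ eᵢ)`. The form `lᵢ (x *
  -- y)` on each summand makes multiplication by `X` self-adjoint because these rings are
  -- commutative.
  obtain ⟨ι, _, p, hp, e, ⟨E⟩⟩ := Module.equiv_directSum_of_isTorsion
    (Module.AEval.isTorsion_of_finiteDimensional F V f)
  choose l hl using fun i => exists_functional_quotient_prime_pow (p i) (hp i) (e i)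
  let E' := E.trans (DirectSum.linearEquivFunOnFintype F[X] ι _)
  let φ : V → ∀ i, F[X] ⧸ Ideal.span {p i ^ e i} := fun v => E' (AEval'.of f v)
  have hadd : ∀ x y, φ (x + y) = φ x + φ y := fun x y => by simp [φ]
  have hsmul : ∀ (c : F) x i, φ (c • x) i = c • φ x i := fun c x i => by
    simp only [φ, map_smul]
    rw [← algebraMap_smul F[X] c (AEval'.of f x), map_smul, algebraMap_smul]
    rfl
  have hX : ∀ x i, φ (f x) i = Ideal.Quotient.mk _ X * φ x i := fun x i => by
    simp only [φ, ← AEval'.X_smul_of, map_smul, Pi.smul_apply]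
    rw [← Ideal.Quotient.algebraMap_eq, Algebra.smul_def]
  have hsurj : Function.Surjective φ := E'.surjective.comp (AEval'.of f).surjective
  have hinj : ∀ x, φ x = 0 → x = 0 := fun x hx => by
    simpa [φ] using hx
  let B : LinearMap.BilinForm F V := LinearMap.mk₂ F (fun x y => ∑ i, l i (φ x i * φ y i))
    (fun x y z => by simp [hadd, add_mul, Finset.sum_add_distrib])
    (fun c x y => by simp only [hsmul, smul_mul_assoc, map_smul, Finset.smul_sum])
    (fun x y z => by simp [hadd, mul_add, Finset.sum_add_distrib])
    (fun c x y => by simp only [hsmul, mul_smul_comm, map_smul, Finset.smul_sum])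
  have hB : ∀ x y, B x y = ∑ i, l i (φ x i * φ y i) := fun x y => rfl
  refine ⟨B, LinearMap.BilinForm.Nondegenerate.ofSeparatingLeft fun x hx => ?_,
    fun x y => by simp [hB, mul_comm], fun x y => by
      simp only [hB, hX]; exact Finset.sum_congr rfl fun i _ => by ring_nf⟩
  refine hinj x (funext fun i => hl i _ fun w => ?_)
  obtain ⟨y, hy⟩ := hsurj (Pi.single i w)
  have := hx y
  rw [hB, hy, Finset.sum_eq_single i] at this
  · simpa using this
  · intro j _ hj
    simp [hj]
  · simp

/-- Every square matrix over a field is a product of two symmetric matrices. -/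
theorem Matrix.exists_eq_mul_isSymm {F n : Type*} [Field F] [Fintype n] [DecidableEq n]
    (A : Matrix n n F) : ∃ S T : Matrix n n F, S.IsSymm ∧ T.IsSymm ∧ A = S * T := by
  obtain ⟨B, hB, hsymm, hA⟩ := exists_nondegenerate_symm_selfAdjoint (Matrix.toLin' A)
  set P := LinearMap.BilinForm.toMatrix' B with hP
  have hPs : P.IsSymm := by
    ext i j
    simp [hP, LinearMap.BilinForm.toMatrix'_apply, hsymm (Pi.single i 1)]
  have hPA : P * A = LinearMap.BilinForm.toMatrix' (LinearMap.compl₂ B (Matrix.toLin' A)) := by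
    conv_lhs => rw [← LinearMap.toMatrix'_toLin' A]
    exact (LinearMap.toMatrix₂'_compl₂ B _).symm
  have hPAs : (P * A).IsSymm := by
    rw [hPA]
    ext i j
    simp only [transpose_apply, LinearMap.BilinForm.toMatrix'_apply, LinearMap.compl₂_apply]
    rw [← hA, hsymm]
  have hdet : IsUnit P.det := by
    have := (LinearMap.BilinForm.nondegenerate_toMatrix'_iff.2 hB).det_ne_zero
    exact this.isUnit
  -- Self-adjointness of `A` for the Gram matrix `P` says that `P * A` is symmetric.
  refine ⟨P⁻¹, P * A, ?_, hPAs, by rw [Matrix.nonsing_inv_mul_cancel_left _ _ hdet]⟩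
  rw [IsSymm, transpose_nonsing_inv, hPs.eq]

/-! ### Making the corner block invertible -/

/-- If `Aᵀ C` is symmetric and `[A; C]` has trivial kernel, then `A - diag(δ) C` is nonsingular
for some vector `δ` with entries `0` and `1`. -/
theorem Matrix.exists_isUnit_sub_diagonal_mul {F n : Type*} [Field F] [Fintype n] [DecidableEq n]
    (A C : Matrix n n F) (hs : (Aᵀ * C).IsSymm) (hk : ∀ v, A *ᵥ v = 0 → C *ᵥ v = 0 → v = 0) :
    ∃ δ : n → F, (∀ i, δ i = 0 ∨ δ i = 1) ∧ IsUnit (A - diagonal δ * C) := by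
  let ε : Finset n → n → F := fun s i => if i ∈ s then 1 else 0
  let K : Finset n → Submodule F (n → F) := fun s =>
    LinearMap.ker (Matrix.toLin' (A - diagonal (ε s) * C))
  have hK : ∀ s v, v ∈ K s ↔ ∀ i, (A *ᵥ v) i = ε s i * (C *ᵥ v) i := fun s v => by
    simp [K, funext_iff, -mulVec_mulVec, mulVec_diagonal, sub_eq_zero]
  -- Take a 0/1 vector with the smallest kernel. If `v ≠ 0` lies in that kernel, flipping `δ` at a
  -- coordinate where `C v` is nonzero removes `v` and adds nothing, contradicting minimality.
  obtain ⟨s, hmin⟩ := Finite.exists_min fun s => Module.finrank F (K s)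
  refine ⟨ε s, fun i => by by_cases h : i ∈ s <;> simp [ε, h], ?_⟩
  have hbot : K s = ⊥ := by
    by_contra hne
    obtain ⟨v, hv, hv0⟩ := Submodule.exists_mem_ne_zero_of_ne_bot hne
    have hCv : ∃ i, (C *ᵥ v) i ≠ 0 := by
      by_contra! h
      refine hv0 (hk v (funext fun i => ?_) (funext h))
      rw [(hK s v).1 hv, h, mul_zero, Pi.zero_apply]
    obtain ⟨i, hi⟩ := hCv
    obtain ⟨t, hti, htj⟩ : ∃ t : Finset n, ε t i ≠ ε s i ∧ ∀ j, j ≠ i → ε t j = ε s j := by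
      by_cases h : i ∈ s
      · exact ⟨s.erase i, by simp [ε, h], fun j hj => by simp [ε, hj]⟩
      · exact ⟨insert i s, by simp [ε, h], fun j hj => by simp [ε, hj]⟩
    refine (hmin t).not_gt (Submodule.finrank_lt_finrank_of_lt
      (lt_of_le_of_ne (fun w hw => ?_) fun h => ?_))
    · have hw' := (hK t w).1 hw
      have key : (A *ᵥ v) ⬝ᵥ (C *ᵥ w) = (C *ᵥ v) ⬝ᵥ (A *ᵥ w) := by
        have h1 : Aᵀ * C = Cᵀ * A := by
          have := hs.eq
          rw [transpose_mul, transpose_transpose] at this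
          exact this.symm
        rw [← vecMul_transpose A v, ← vecMul_transpose C v, ← dotProduct_mulVec,
          ← dotProduct_mulVec, mulVec_mulVec, mulVec_mulVec, h1]
      -- The symmetry of `AᵀC` becomes a sum in which only the flipped coordinate survives, so `(C
      -- w) i = 0` and `w` does not see the flip.
      have h0 : (ε s i - ε t i) * (C *ᵥ v) i * (C *ᵥ w) i = 0 := by
        have : ∑ j, (ε s j - ε t j) * (C *ᵥ v) j * (C *ᵥ w) j = 0 := by
          have := sub_eq_zero.2 key
          rw [dotProduct, dotProduct, ← Finset.sum_sub_distrib] at this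
          rw [← this]
          refine Finset.sum_congr rfl fun j _ => ?_
          rw [(hK s v).1 hv, hw']
          ring
        rwa [Finset.sum_eq_single i (fun j _ hj => by simp [htj j hj]) (by simp)] at this
      have hw0 : (C *ᵥ w) i = 0 := by
        simpa [sub_eq_zero, hti.symm, hi] using h0
      refine (hK s w).2 fun j => ?_
      by_cases hj : j = i
      · rw [hw', hj, hw0, mul_zero, mul_zero]
      · rw [hw', htj j hj]
    · have h1 := (hK s v).1 hv i
      rw [(hK t v).1 (h ▸ hv) i] at h1
      exact hti (mul_right_cancel₀ hi h1)
  rw [← Matrix.mulVec_injective_iff_isUnit]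
  exact LinearMap.ker_eq_bot.1 hbot

/-! ### Factorization into five factors -/

namespace SympFactor

section

variable {n R : Type*} [Fintype n] [DecidableEq n] [CommRing R]

theorem upper_mul_upper (S T : Matrix n n R) :
    (fromBlocks 1 S 0 1 * fromBlocks 1 T 0 1 : Matrix (n ⊕ n) (n ⊕ n) R) = fromBlocks 1 (S + T) 0 1 := by
  simp [fromBlocks_multiply, add_comm]

theorem lower_mul_lower (S T : Matrix n n R) :
    (fromBlocks 1 0 S 1 * fromBlocks 1 0 T 1 : Matrix (n ⊕ n) (n ⊕ n) R) = fromBlocks 1 0 (S + T) 1 := by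
  simp [fromBlocks_multiply]

theorem upper_mem {S : Matrix n n R} (hS : S.IsSymm) :
    fromBlocks 1 S 0 1 ∈ symplecticGroup n R := by
  simp [SymplecticGroup.fromBlocks_mem_iff, hS.eq]

theorem lower_mem {S : Matrix n n R} (hS : S.IsSymm) :
    fromBlocks 1 0 S 1 ∈ symplecticGroup n R := by
  simp [SymplecticGroup.fromBlocks_mem_iff, hS.eq]

/-- Block LDU factorization of a symplectic matrix with invertible upper left block. -/
theorem exists_eq_lower_mul_diag_mul_upper {A B C D : Matrix n n R}
    (h : fromBlocks A B C D ∈ symplecticGroup n R) (hA : IsUnit A) :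
    ∃ X Y : Matrix n n R, X.IsSymm ∧ Y.IsSymm ∧ fromBlocks A B C D =
      fromBlocks 1 0 X 1 * fromBlocks A 0 0 (A⁻¹)ᵀ * fromBlocks 1 Y 0 1 := by
  have hdet := (isUnit_iff_isUnit_det A).1 hA
  have h1 : A * A⁻¹ = 1 := mul_nonsing_inv A hdet
  have h2 : A⁻¹ * A = 1 := nonsing_inv_mul A hdet
  have h1t : (A⁻¹)ᵀ * Aᵀ = 1 := by rw [← transpose_mul, h1, transpose_one]
  have h' := SymplecticGroup.transpose_mem h
  rw [fromBlocks_transpose, SymplecticGroup.fromBlocks_mem_iff] at h'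
  rw [SymplecticGroup.fromBlocks_mem_iff] at h
  obtain ⟨hC, -, hD⟩ := h
  have hB := h'.1
  simp only [transpose_transpose] at hB
  have hX : (A⁻¹)ᵀ * Cᵀ = C * A⁻¹ := by
    calc (A⁻¹)ᵀ * Cᵀ = (A⁻¹)ᵀ * (Cᵀ * A) * A⁻¹ := by
          rw [Matrix.mul_assoc, Matrix.mul_assoc Cᵀ, h1, Matrix.mul_one]
      _ = C * A⁻¹ := by rw [← hC, ← Matrix.mul_assoc, h1t, Matrix.one_mul]
  have hY : Bᵀ * (A⁻¹)ᵀ = A⁻¹ * B := by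
    calc Bᵀ * (A⁻¹)ᵀ = A⁻¹ * (A * Bᵀ) * (A⁻¹)ᵀ := by
          rw [← Matrix.mul_assoc, h2, Matrix.one_mul]
      _ = A⁻¹ * B := by
          rw [hB, Matrix.mul_assoc, Matrix.mul_assoc B, ← transpose_mul, h2, transpose_one,
            Matrix.mul_one]
  refine ⟨C * A⁻¹, A⁻¹ * B, by rw [IsSymm, transpose_mul, hX], by rw [IsSymm, transpose_mul, hY],
    ?_⟩
  have hD' : D = C * A⁻¹ * B + (A⁻¹)ᵀ := by
    rw [← hX, Matrix.mul_assoc]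
    calc D = (A⁻¹)ᵀ * (Aᵀ * D) := by rw [← Matrix.mul_assoc, h1t, Matrix.one_mul]
      _ = (A⁻¹)ᵀ * (Cᵀ * B) + (A⁻¹)ᵀ := by rw [sub_eq_iff_eq_add'.1 hD, Matrix.mul_add,
            Matrix.mul_one]
  rw [fromBlocks_multiply, fromBlocks_multiply, fromBlocks_inj]
  refine ⟨by simp, by simp [← Matrix.mul_assoc, h1], by simp [Matrix.mul_assoc, h2], ?_⟩
  have h3 : C * A⁻¹ * A = C := by rw [Matrix.mul_assoc, h2, Matrix.mul_one]
  simp only [Matrix.one_mul, Matrix.mul_zero, add_zero, zero_add, Matrix.mul_one, h3]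
  rw [← Matrix.mul_assoc, ← hD']

end

section

variable {n F : Type*} [Fintype n] [DecidableEq n] [Field F]

/-- A symplectic matrix with invertible upper left block is a product of four unit triangular
symplectic matrices. -/
theorem exists_eq_four_of_isUnit {A B C D : Matrix n n F}
    (h : fromBlocks A B C D ∈ symplecticGroup n F) (hA : IsUnit A) :
    ∃ S T U V : Matrix n n F, S.IsSymm ∧ T.IsSymm ∧ U.IsSymm ∧ V.IsSymm ∧
      fromBlocks A B C D = fromBlocks 1 0 S 1 * fromBlocks 1 T 0 1 *
        fromBlocks 1 0 U 1 * fromBlocks 1 V 0 1 := by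
  obtain ⟨T, U, hT, hU, hTU⟩ := Matrix.exists_eq_mul_isSymm (A - 1)
  have hM : fromBlocks 1 T 0 1 * fromBlocks 1 0 U 1 = fromBlocks A T U 1 := by
    simp [fromBlocks_multiply, ← hTU]
  obtain ⟨X, Y, hX, hY, hXY⟩ := exists_eq_lower_mul_diag_mul_upper h hA
  obtain ⟨X', Y', hX', hY', hXY'⟩ := exists_eq_lower_mul_diag_mul_upper
    (hM ▸ mul_mem (upper_mem hT) (lower_mem hU)) hA
  -- Both block LDU factorizations have middle factor `diag(A, A⁻ᵀ)`, so they differ only in the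
  -- outer shears.
  refine ⟨X - X', T, U, Y - Y', hX.sub hX', hT, hU, hY.sub hY', ?_⟩
  rw [Matrix.mul_assoc (fromBlocks 1 0 (X - X') 1), hM, hXY', hXY]
  simp only [← Matrix.mul_assoc, lower_mul_lower, sub_add_cancel]
  rw [Matrix.mul_assoc _ (fromBlocks 1 Y' 0 1), upper_mul_upper, add_sub_cancel]

theorem exists_eq_five {H : Matrix (n ⊕ n) (n ⊕ n) F} (hH : H ∈ symplecticGroup n F) :
    ∃ δ : n → F, (∀ i, δ i = 0 ∨ δ i = 1) ∧
      ∃ S T U V : Matrix n n F, S.IsSymm ∧ T.IsSymm ∧ U.IsSymm ∧ V.IsSymm ∧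
        H = fromBlocks 1 (diagonal δ) 0 1 * fromBlocks 1 0 S 1 * fromBlocks 1 T 0 1 *
          fromBlocks 1 0 U 1 * fromBlocks 1 V 0 1 := by
  obtain ⟨A, B, C, D, rfl⟩ : ∃ A B C D, H = fromBlocks A B C D :=
    ⟨_, _, _, _, (fromBlocks_toBlocks H).symm⟩
  obtain ⟨hAC, hBD, hAD⟩ := SymplecticGroup.fromBlocks_mem_iff.1 hH
  obtain ⟨δ, hδ, hu⟩ := Matrix.exists_isUnit_sub_diagonal_mul A C
    -- The transpose of `AᵀD - CᵀB = 1` is `DᵀA - BᵀC = 1`, so `A v = C v = 0` forces `v = 0`.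
    (by rw [IsSymm, transpose_mul, transpose_transpose, hAC]) fun v hA hC => by
      have h := congrArg (fun M => Mᵀ *ᵥ v) hAD
      simpa [sub_mulVec, ← mulVec_mulVec, hA, hC, eq_comm] using h
  have hmul : fromBlocks 1 (-diagonal δ) 0 1 * fromBlocks A B C D =
      fromBlocks (A - diagonal δ * C) (B - diagonal δ * D) C D := by
    simp only [fromBlocks_multiply, Matrix.one_mul, Matrix.zero_mul, Matrix.neg_mul, zero_add,
      sub_eq_add_neg]
  obtain ⟨S, T, U, V, hS, hT, hU, hV, h⟩ := exists_eq_four_of_isUnit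
    (hmul ▸ mul_mem (upper_mem (isSymm_diagonal δ).neg) hH) hu
  refine ⟨δ, hδ, S, T, U, V, hS, hT, hU, hV, ?_⟩
  rw [← hmul] at h
  simp only [Matrix.mul_assoc] at h ⊢
  rw [← h, ← Matrix.mul_assoc, upper_mul_upper, add_neg_cancel,
    fromBlocks_one, Matrix.one_mul]

end

/-! ### Four factors do not suffice -/

variable {d : ℕ} {F : Type*} [Field F]

/-- The unit triangular block matrix with off-diagonal block `S`, upper if `b` is true. -/
def triangle (b : Bool) (S : Matrix (Fin d) (Fin d) F) :
    Matrix (Fin d ⊕ Fin d) (Fin d ⊕ Fin d) F :=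
  if b then fromBlocks 1 S 0 1 else fromBlocks 1 0 S 1

theorem triangle_zero (b : Bool) : triangle b (0 : Matrix (Fin d) (Fin d) F) = 1 := by
  cases b <;> simp [triangle]

theorem triangle_mul (b : Bool) (S T : Matrix (Fin d) (Fin d) F) :
    triangle b S * triangle b T = triangle b (S + T) := by
  cases b <;> simp [triangle, upper_mul_upper, lower_mul_lower]

/-- Alternating products of `n` unit triangular symplectic matrices, the first one being upper
if `b` is true. -/
def alternatingProducts (d : ℕ) (F : Type*) [Field F] :
    Bool → ℕ → Set (Matrix (Fin d ⊕ Fin d) (Fin d ⊕ Fin d) F)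
  | _, 0 => {1}
  | b, n + 1 => {H | ∃ S : Matrix (Fin d) (Fin d) F, S.IsSymm ∧
      ∃ X ∈ alternatingProducts d F (!b) n, H = triangle b S * X}

theorem alternatingProducts_subset_succ (b : Bool) (n : ℕ) :
    alternatingProducts d F b n ⊆ alternatingProducts d F b (n + 1) := by
  induction n generalizing b with
  | zero =>
    rintro _ rfl
    exact ⟨0, isSymm_zero, 1, rfl, by rw [triangle_zero, mul_one]⟩
  | succ n ih =>
    rintro _ ⟨S, hS, X, hX, rfl⟩
    exact ⟨S, hS, X, ih _ hX, rfl⟩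

/-- Adjacent factors of the same type merge by adding their blocks; the lost length is restored by
padding with an identity factor. -/
theorem unitTriangularProducts_subset_alternatingProducts (n : ℕ)
    {H : Matrix (Fin d ⊕ Fin d) (Fin d ⊕ Fin d) F} (hH : H ∈ unitTriangularProducts d F n) :
    ∃ b, H ∈ alternatingProducts d F b n := by
  obtain ⟨l, rfl, hl, rfl⟩ := hH
  induction l with
  | nil => exact ⟨true, rfl⟩
  | cons M l ih =>
    obtain ⟨b, hb⟩ := ih fun N hN => hl N (List.mem_cons_of_mem _ hN)
    obtain ⟨c, S, hS, rfl⟩ : ∃ c S, S.IsSymm ∧ M = triangle c S := by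
      obtain ⟨S, hS, h | h⟩ := hl M List.mem_cons_self
      · exact ⟨true, S, hS, h⟩
      · exact ⟨false, S, hS, h⟩
    refine ⟨c, ?_⟩
    rw [List.prod_cons, List.length_cons]
    rcases Bool.eq_or_eq_not b c with rfl | rfl
    · generalize l.prod = X at hb
      generalize l.length = m at hb
      cases m with
      | zero => exact ⟨S, hS, X, hb, rfl⟩
      | succ m =>
        obtain ⟨T, hT, Y, hY, rfl⟩ := hb
        exact alternatingProducts_subset_succ _ _
          ⟨S + T, hS.add hT, Y, hY, by rw [← mul_assoc, triangle_mul]⟩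
    · exact ⟨S, hS, _, hb, rfl⟩

/-- The leftmost factor leaves one block row untouched. In that row, the vanishing diagonal block
cancels the last factor's contribution, so the off-diagonal block equals the symmetric block `T` of
the second factor. -/
theorem isSymm_of_fromBlocks_zero_mem {Q R : Matrix (Fin d) (Fin d) F}
    (h : fromBlocks 0 Q R 0 ∈ unitTriangularProducts d F 4) : Q.IsSymm ∨ R.IsSymm := by
  obtain ⟨b, S, hS, _, ⟨T, hT, _, ⟨V, hV, _, ⟨W, hW, _, rfl, rfl⟩, rfl⟩, rfl⟩, h⟩ :=
    unitTriangularProducts_subset_alternatingProducts 4 h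
  cases b
  · left
    simp only [triangle, Bool.not_false, Bool.not_true, if_true, Bool.false_eq_true, if_false,
      mul_one, fromBlocks_multiply, fromBlocks_inj, Matrix.one_mul,
      Matrix.zero_mul, Matrix.mul_zero, add_zero, zero_add] at h
    obtain ⟨h1, h2, -, -⟩ := h
    have : Q = T + (1 + T * V) * W := by rw [h2]; noncomm_ring
    rwa [this, ← h1, Matrix.zero_mul, add_zero]
  · right
    simp only [triangle, Bool.not_false, Bool.not_true, if_true, Bool.false_eq_true, if_false,
      mul_one, fromBlocks_multiply, fromBlocks_inj, Matrix.one_mul,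
      Matrix.zero_mul, Matrix.mul_zero, add_zero, zero_add] at h
    obtain ⟨-, -, h1, h2⟩ := h
    have : R = T + (T * V + 1) * W := by rw [h1]; noncomm_ring
    rwa [this, ← h2, Matrix.zero_mul, add_zero]

theorem fromBlocks_zero_mem_and_notMem {Q : Matrix (Fin d) (Fin d) F} (hQ : IsUnit Q)
    (hs : ¬ Q.IsSymm) : fromBlocks 0 Q (-(Qᵀ)⁻¹) 0 ∈ symplecticGroup (Fin d) F ∧
      fromBlocks 0 Q (-(Qᵀ)⁻¹) 0 ∉ unitTriangularProducts d F 4 := by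
  have hdet := (isUnit_iff_isUnit_det Q).1 hQ
  constructor
  · rw [SymplecticGroup.fromBlocks_mem_iff]
    simp [transpose_nonsing_inv, nonsing_inv_mul Q hdet]
  · intro h
    refine (isSymm_of_fromBlocks_zero_mem h).elim hs fun h => hs ?_
    have h2 : (Qᵀ)⁻¹ = Q⁻¹ := by
      simpa [IsSymm, transpose_nonsing_inv] using h.symm
    have h3 := congrArg (·⁻¹) h2
    simpa [IsSymm, nonsing_inv_nonsing_inv _ hdet,
      nonsing_inv_nonsing_inv Qᵀ (by rwa [det_transpose])] using h3

theorem unitTriangularProducts_subset_symplecticGroup (n : ℕ) :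
    unitTriangularProducts d F n ⊆ symplecticGroup (Fin d) F := by
  rintro _ ⟨l, -, hl, rfl⟩
  refine list_prod_mem fun M hM => ?_
  obtain ⟨S, hS, rfl | rfl⟩ := hl M hM
  · exact upper_mem hS
  · exact lower_mem hS

theorem unitTriangularProducts_mono : Monotone (unitTriangularProducts d F) := by
  refine monotone_nat_of_le_succ fun n => ?_
  rintro _ ⟨l, rfl, hl, rfl⟩
  refine ⟨1 :: l, rfl, ?_, by simp⟩
  rintro M hM
  obtain rfl | hM := List.mem_cons.1 hM
  · exact ⟨0, isSymm_zero, Or.inl (by simp)⟩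
  · exact hl M hM

theorem symplecticGroup_eq_unitTriangularProducts_five :
    (symplecticGroup (Fin d) F : Set (Matrix (Fin d ⊕ Fin d) (Fin d ⊕ Fin d) F)) =
      unitTriangularProducts d F 5 := by
  refine subset_antisymm (fun H hH => ?_) (unitTriangularProducts_subset_symplecticGroup 5)
  obtain ⟨δ, -, S, T, U, V, hS, hT, hU, hV, h⟩ := exists_eq_five hH
  refine ⟨[fromBlocks 1 (diagonal δ) 0 1, fromBlocks 1 0 S 1, fromBlocks 1 T 0 1,
    fromBlocks 1 0 U 1, fromBlocks 1 V 0 1], rfl, ?_, by simp [h, Matrix.mul_assoc]⟩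
  simp only [List.mem_cons, List.not_mem_nil, or_false]
  rintro M (rfl | rfl | rfl | rfl | rfl)
  exacts [⟨_, isSymm_diagonal δ, Or.inl rfl⟩, ⟨S, hS, Or.inr rfl⟩, ⟨T, hT, Or.inl rfl⟩,
    ⟨U, hU, Or.inr rfl⟩, ⟨V, hV, Or.inl rfl⟩]

theorem exists_isUnit_not_isSymm (hd : 2 ≤ d) :
    ∃ Q : Matrix (Fin d) (Fin d) F, IsUnit Q ∧ ¬ Q.IsSymm := by
  have hne : (⟨0, by omega⟩ : Fin d) ≠ ⟨1, by omega⟩ := by simp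
  refine ⟨transvection ⟨0, by omega⟩ ⟨1, by omega⟩ 1, ?_, fun h => ?_⟩
  · rw [isUnit_iff_isUnit_det, det_transvection_of_ne _ _ hne]
    exact isUnit_one
  · have := h.apply ⟨0, by omega⟩ ⟨1, by omega⟩
    simp [transvection, one_apply] at this

theorem unitTriangularProducts_four_ssubset (hd : 2 ≤ d) :
    unitTriangularProducts d F 4 ⊂
      (symplecticGroup (Fin d) F : Set (Matrix (Fin d ⊕ Fin d) (Fin d ⊕ Fin d) F)) := by
  obtain ⟨Q, hQ, hs⟩ := exists_isUnit_not_isSymm (F := F) hd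
  obtain ⟨h1, h2⟩ := fromBlocks_zero_mem_and_notMem hQ hs
  exact (Set.ssubset_iff_of_subset (unitTriangularProducts_subset_symplecticGroup 4)).2
    ⟨_, h1, h2⟩

end SympFactor

theorem mainTheorem1 (F : Type*) [Field F] (d : ℕ) (hd : 2 ≤ d) :
    (∀ H ∈ symplecticGroup (Fin d) F,
      ∃ δ : Fin d → F, (∀ i, δ i = 0 ∨ δ i = 1) ∧
      ∃ S T U V : Matrix (Fin d) (Fin d) F,
        S.IsSymm ∧ T.IsSymm ∧ U.IsSymm ∧ V.IsSymm ∧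
        H = fromBlocks 1 (diagonal δ) 0 1 * fromBlocks 1 0 S 1 * fromBlocks 1 T 0 1 *
          fromBlocks 1 0 U 1 * fromBlocks 1 V 0 1) ∧
    (symplecticGroup (Fin d) F : Set (Matrix (Fin d ⊕ Fin d) (Fin d ⊕ Fin d) F)) =
      SympFactor.unitTriangularProducts d F 5 ∧
    SympFactor.unitTriangularProducts d F 4 ⊂
      (symplecticGroup (Fin d) F : Set (Matrix (Fin d ⊕ Fin d) (Fin d ⊕ Fin d) F)) ∧
    (∀ Q : Matrix (Fin d) (Fin d) F, IsUnit Q → ¬ Q.IsSymm →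
      fromBlocks 0 Q (-(Qᵀ)⁻¹) 0 ∈ symplecticGroup (Fin d) F ∧
      fromBlocks 0 Q (-(Qᵀ)⁻¹) 0 ∉ SympFactor.unitTriangularProducts d F 4) ∧
    IsLeast {n : ℕ | SympFactor.unitTriangularProducts d F n =
      (symplecticGroup (Fin d) F : Set (Matrix (Fin d ⊕ Fin d) (Fin d ⊕ Fin d) F))} 5 := by
  have h4 := SympFactor.unitTriangularProducts_four_ssubset (F := F) hd
  have h5 := SympFactor.symplecticGroup_eq_unitTriangularProducts_five (d := d) (F := F)
  refine ⟨fun H hH => SympFactor.exists_eq_five hH, h5, h4,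
    fun Q hQ hs => SympFactor.fromBlocks_zero_mem_and_notMem hQ hs, h5.symm, fun n hn => ?_⟩
  by_contra! hlt
  -- A smaller `n` would, by monotonicity, already give the whole group with four factors.
  have hle := SympFactor.unitTriangularProducts_mono (d := d) (F := F) (Nat.le_of_lt_succ hlt)
  rw [Set.mem_ofPred_eq] at hn
  rw [hn] at hle
  exact h4.not_subset hle
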